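/- Let $G$ be a finite group. For $g\in G$ and $H\le G$ write ${}^gH=gHg^{-1}$, and write $C_G(H)$ for the centralizer of $H$ in $G$. A $\mathbb{Q}$-Green functor $A$ for $G$ assigns to every subgroup $H\le G$ an associative unital $\mathbb{Q}$-algebra $A(H)$ with identity $1_H$, together with unital $\mathbb{Q}$-algebra homomorphisms $\mathrm{Res}^K_H\colon A(K)\to A(H)$ and $\mathbb{Q}$-linear maps $\mathrm{Ind}_H^K\colon A(H)\to A(K)$ for $H\le K\le G$, and unital $\mathbb{Q}$-algebra homomorphisms $c_g\colon A(H)\to A({}^gH)$ for $H\le G$, $g\in G$, such that: $\mathrm{Res}$ and $\mathrm{Ind}$ are transitive and $\mathrm{Res}^H_H=\mathrm{Ind}_H^H=\mathrm{id}$; $c_{g'}c_g=c_{g'g}$, and $c_h=\mathrm{id}$ on $A(H)$ for $h\in H$; conjugation commutes with $\mathrm{Res}$ and $\mathrm{Ind}$; the Mackey formula $\mathrm{Res}^K_L\mathrm{Ind}_H^K=\sum_{t\in[L\backslash K/H]}\mathrm{Ind}_{L\cap{}^tH}^L\,\mathrm{Res}^{{}^tH}_{L\cap{}^tH}\,c_t$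 holds for $L,H\le K$; and the Frobenius relations $a\cdot\mathrm{Ind}_H^K(b)=\mathrm{Ind}_H^K(\mathrm{Res}^K_H(a)\,b)$ and $\mathrm{Ind}_H^K(b)\cdot a=\mathrm{Ind}_H^K(b\,\mathrm{Res}^K_H(a))$ hold for $H\le K$, $a\in A(K)$, $b\in A(H)$. A subgroup $H\le G$ is called primordial for $A$ if the map $\bigoplus_{K<H}A(K)\to A(H)$ with components $\mathrm{Ind}_K^H$, where $K$ runs over the proper subgroups of $H$, is not surjective. For a finite poset $P$, let $\chi(P)=\sum_{x\in P}k(x)$, where $k\colon P\to\mathbb{Q}$ is the weighting on $P$, that is, the function with $\sum_{y\ge x}k(y)=1$ for all $x\in P$; and let $\tilde\chi(P)=\chi(P)-1$ (so $\tilde\chi(\emptyset)=-1$). **Theorem.** Let $A$ be a $\mathbb{Q}$-Green functor for $G$, and let $\mathcal{S}$ be a set of subgroups of $G$ that is closed under conjugation by elements of $G$ and contains $C_G(K)$ for every primordial subgroup $K$ of $A$. Then $$1_G=\sum_{H\in\mathcal{S}}\frac{-\tilde\chi(\mathcal{S}_{<H})}{|G:C_G(H)|}\,\mathrm{Ind}_{C_G(H)}^G\bigl(1_{C_G(H)}\bigr)\quad\text{in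 }A(G),$$ where $\mathcal{S}_{<H}=\{K\in\mathcal{S}: K<H\}$ is ordered by inclusion. -/

import Mathlib

open scoped Pointwise

universe u v

/-! ### Euler characteristic of a finite poset -/

section EulerCharacteristic

variable (P : Type u) [PartialOrder P]

/-- `k` is a weighting on the poset `P`, regarded as a category: `∑_y ζ(x, y) k(y) = 1` for all
`x`, where `ζ(x, y)` is the number of morphisms `x ⟶ y`, that is, `1` if `x ≤ y` and `0`
otherwise. -/
def IsPosetWeighting (k : P → ℚ) : Prop :=
  ∀ x : P, ∑ᶠ y ∈ Set.Ici x, k y = 1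

/-- `k` is a coweighting on the poset `P`: `∑_x k(x) ζ(x, y) = 1` for all `y`. -/
def IsPosetCoweighting (k : P → ℚ) : Prop :=
  ∀ y : P, ∑ᶠ x ∈ Set.Iic y, k x = 1

open Classical in
/-- The Euler characteristic of a finite poset `P` is the total weight of a weighting, provided
that `P` has a weighting and a coweighting; the value does not depend on the choice
(`posetEulerChar_eq`), and both exist for every finite poset (`exists_isPosetWeighting`,
`exists_isPosetCoweighting`). -/
noncomputable def posetEulerChar [Finite P] : ℚ :=
  if h : (∃ k, IsPosetWeighting P k) ∧ (∃ k', IsPosetCoweighting P k') then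
    ∑ᶠ x, h.1.choose x
  else 0

/-- The reduced Euler characteristic `χ(P) - 1` of a finite poset. -/
noncomputable def reducedPosetEulerChar [Finite P] : ℚ :=
  posetEulerChar P - 1

theorem exists_isPosetWeighting [Finite P] : ∃ k, IsPosetWeighting P k := by
  classical
  have wf : WellFounded ((· > ·) : P → P → Prop) := wellFounded_gt
  refine ⟨wf.fix (fun x f => 1 - ∑ᶠ y : {y // y > x}, f y.1 y.2), fun x => ?_⟩
  have hx := wf.fix_eq (fun x (f : ∀ y, y > x → ℚ) => 1 - ∑ᶠ y : {y // y > x}, f y.1 y.2) x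
  have hs : Set.Ici x = insert x (Set.Ioi x) := by
    ext y; simp [le_iff_eq_or_lt]
  rw [hs, finsum_mem_insert _ (by simp) (Set.toFinite _), hx]
  set F := wf.fix (fun x (f : ∀ y, y > x → ℚ) => 1 - ∑ᶠ y : {y // y > x}, f y.1 y.2)
  have h2 : (∑ᶠ y : {y // y > x}, F y.1) = ∑ᶠ y ∈ Set.Ioi x, F y :=
    finsum_set_coe_eq_finsum_mem (Set.Ioi x)
  rw [h2]
  ring

theorem exists_isPosetCoweighting [Finite P] : ∃ k, IsPosetCoweighting P k := by
  obtain ⟨k, hk⟩ := exists_isPosetWeighting Pᵒᵈ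
  exact ⟨fun x => k (OrderDual.toDual x), fun y => hk (OrderDual.toDual y)⟩

variable {P}

theorem IsPosetWeighting.sum_eq [Finite P] {k k' : P → ℚ} (hk : IsPosetWeighting P k)
    (hk' : IsPosetCoweighting P k') : ∑ᶠ x, k x = ∑ᶠ x, k' x := by
  classical
  cases nonempty_fintype P
  have h1 : ∀ x : P, ∑ y, (if x ≤ y then k y else 0) = 1 := fun x => by
    rw [← hk x, finsum_eq_sum_of_fintype]
    exact Finset.sum_congr rfl fun y _ => by simp [finsum_eq_if]
  have h2 : ∀ y : P, ∑ x, (if x ≤ y then k' x else 0) = 1 := fun y => by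
    rw [← hk' y, finsum_eq_sum_of_fintype]
    exact Finset.sum_congr rfl fun x _ => by simp [finsum_eq_if]
  rw [finsum_eq_sum_of_fintype, finsum_eq_sum_of_fintype]
  calc ∑ y, k y = ∑ y, k y * ∑ x, (if x ≤ y then k' x else 0) := by simp [h2]
    _ = ∑ x, ∑ y, k y * (if x ≤ y then k' x else 0) := by
      simp_rw [Finset.mul_sum]; exact Finset.sum_comm
    _ = ∑ x, k' x * ∑ y, (if x ≤ y then k y else 0) := by
      simp_rw [Finset.mul_sum]
      refine Finset.sum_congr rfl fun x _ => Finset.sum_congr rfl fun y _ => ?_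
      split_ifs <;> ring
    _ = ∑ x, k' x := by simp [h1]

theorem posetEulerChar_eq [Finite P] {k : P → ℚ} (hk : IsPosetWeighting P k) :
    posetEulerChar P = ∑ᶠ x, k x := by
  obtain ⟨k', hk'⟩ := exists_isPosetCoweighting P
  have h : (∃ k, IsPosetWeighting P k) ∧ (∃ k', IsPosetCoweighting P k') :=
    ⟨⟨k, hk⟩, ⟨k', hk'⟩⟩
  rw [posetEulerChar, dif_pos h]
  exact (h.1.choose_spec.sum_eq hk').trans (hk.sum_eq hk').symm

end EulerCharacteristic

/-! ### Rational Green functors -/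

/-- `T` is a set of representatives of the double cosets `L \ K / H` (for `L, H ≤ K`). -/
def IsDoubleCosetTransversal {G : Type u} [Group G] (L K H : Subgroup G) (T : Finset G) : Prop :=
  (∀ t ∈ T, t ∈ K) ∧ ∀ k ∈ K, ∃! t, t ∈ T ∧ ∃ l ∈ L, ∃ h ∈ H, k = l * t * h

/-- A `ℚ`-Green functor for the group `G`. The conjugate `ᵍH = g H g⁻¹` is `MulAut.conj g • H`;
the conjugation map `c_g : A(H) → A(ᵍH)` is written with a variable target `H'` that is equal to
`ᵍH`, which avoids transports along equalities of subgroups. -/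
structure RationalGreenFunctor (G : Type u) [Group G] where
  /-- The algebra `A(H)`. -/
  obj : Subgroup G → Type v
  [ring : ∀ H, Ring (obj H)]
  [algebra : ∀ H, Algebra ℚ (obj H)]
  /-- Restriction `A(K) → A(H)`, a unital algebra homomorphism. -/
  res : ∀ {H K : Subgroup G}, H ≤ K → obj K →ₐ[ℚ] obj H
  /-- Induction `A(H) → A(K)`, a linear map. -/
  ind : ∀ {H K : Subgroup G}, H ≤ K → obj H →ₗ[ℚ] obj K
  /-- Conjugation `A(H) → A(ᵍH)`, a unital algebra homomorphism. -/
  conj : ∀ (g : G) {H H' : Subgroup G}, MulAut.conj g • H = H' → obj H →ₐ[ℚ] obj H'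
  res_self : ∀ (H : Subgroup G) (a : obj H), res (le_refl H) a = a
  ind_self : ∀ (H : Subgroup G) (a : obj H), ind (le_refl H) a = a
  res_res : ∀ {H K L : Subgroup G} (hHK : H ≤ K) (hKL : K ≤ L) (a : obj L),
    res hHK (res hKL a) = res (hHK.trans hKL) a
  ind_ind : ∀ {H K L : Subgroup G} (hHK : H ≤ K) (hKL : K ≤ L) (a : obj H),
    ind hKL (ind hHK a) = ind (hHK.trans hKL) a
  conj_of_mem : ∀ {g : G} {H : Subgroup G}, g ∈ H → ∀ (h : MulAut.conj g • H = H) (a : obj H),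
    conj g h a = a
  conj_conj : ∀ {g g' : G} {H H' H'' : Subgroup G} (h : MulAut.conj g • H = H')
    (h' : MulAut.conj g' • H' = H'') (h'' : MulAut.conj (g' * g) • H = H'') (a : obj H),
    conj g' h' (conj g h a) = conj (g' * g) h'' a
  conj_res : ∀ {g : G} {H K H' K' : Subgroup G} (hHK : H ≤ K) (hHK' : H' ≤ K')
    (hH : MulAut.conj g • H = H') (hK : MulAut.conj g • K = K') (a : obj K),
    conj g hH (res hHK a) = res hHK' (conj g hK a)
  conj_ind : ∀ {g : G} {H K H' K' : Subgroup G} (hHK : H ≤ K) (hHK' : H' ≤ K')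
    (hH : MulAut.conj g • H = H') (hK : MulAut.conj g • K = K') (a : obj H),
    conj g hK (ind hHK a) = ind hHK' (conj g hH a)
  /-- The Mackey formula. -/
  res_ind : ∀ {L H K : Subgroup G} (hL : L ≤ K) (hH : H ≤ K) (T : Finset G),
    IsDoubleCosetTransversal L K H T → ∀ a : obj H,
      res hL (ind hH a) =
        ∑ t ∈ T, ind (inf_le_left : L ⊓ MulAut.conj t • H ≤ L)
          (res (inf_le_right : L ⊓ MulAut.conj t • H ≤ MulAut.conj t • H) (conj t rfl a))
  /-- The Frobenius relations. -/
  mul_ind : ∀ {H K : Subgroup G} (h : H ≤ K) (a : obj K) (b : obj H),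
    a * ind h b = ind h (res h a * b)
  ind_mul : ∀ {H K : Subgroup G} (h : H ≤ K) (b : obj H) (a : obj K),
    ind h b * a = ind h (b * res h a)

namespace RationalGreenFunctor

attribute [instance] RationalGreenFunctor.ring RationalGreenFunctor.algebra

variable {G : Type u} [Group G] (A : RationalGreenFunctor.{u, v} G)

open Classical in
/-- The map `⨁_{K < H} A(K) → A(H)` whose components are the induction maps. -/
noncomputable def properInduction (H : Subgroup G) :
    (DirectSum {K : Subgroup G // K < H} fun K => A.obj K.1) →ₗ[ℚ] A.obj H :=
  DirectSum.toModule ℚ {K : Subgroup G // K < H} (A.obj H) fun K => A.ind K.2.le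

/-- The set of primordial subgroups: those `H` such that `A(H)` is not spanned by elements induced
from proper subgroups of `H`. -/
def primordial : Set (Subgroup G) :=
  {H | ¬ Function.Surjective (A.properInduction H)}

end RationalGreenFunctor

/-- `χ̃(S_{<H})`, where `S_{<H}` is the poset of those members of `S` that are properly contained
in `H`, ordered by inclusion. -/
noncomputable def reducedEulerCharBelow {G : Type u} [Group G] [Finite G]
    (S : Set (Subgroup G)) (H : Subgroup G) : ℚ :=
  reducedPosetEulerChar {K : Subgroup G // K ∈ S ∧ K < H}

/-! ### Möbius inversion and Weisner's theorem -/

section MoebiusInversion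

open Finset

variable {α : Type*} [Fintype α] [DecidableEq α]

/-! Put `e_L = (|L|/|G|) Ind_L^G(1)`, so `e_G = 1`, and Möbius-invert: `e_L = ∑_{K ≤ L} f(K)`. The
crux is that `f(K) = 0` for non-primordial `K` (`exists_normInd_eq_sum`). Indeed `f(K)` is a
multiple of an element induced from `x = ∑_L μ(L,K) (|L|/|K|) Ind_L^K(1)` in `A(K)`. By Mackey
(`res_normInd`) and Weisner (`sum_mu_smul_inf_eq_zero`), `x` restricts to zero on every proper
subgroup, and Frobenius then gives `x = 0` (`eq_zero_of_res_eq_zero`).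

The right-hand side of the theorem is `∑_{H ∈ S} -χ̃(S_{<H}) e_{C(H)}`. Since `K ≤ C(H)` iff `H ≤
C(K)`, the coefficient of `f(K)` in it is the sum of `-χ̃(S_{<H})` over `H ∈ S` with `H ≤ C(K)`.
This is `1` when `C(K) ∈ S`, because `H ↦ -χ̃(S_{<H})` is the coweighting of `S`
(`sum_neg_reducedEulerCharBelow`). What remains is `∑ f(K) = e_G = 1`. -/

theorem sum_ite_mu_eq_ite [PartialOrder α] [LocallyFiniteOrder α] [DecidableLE α] (h k : α) :
    ∑ l, (if h ≤ l then IncidenceAlgebra.mu ℚ l k else 0) = if h = k then 1 else 0 := by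
  rw [← IncidenceAlgebra.sum_Icc_mu_left, ← sum_filter]
  symm
  refine sum_subset (fun x hx => ?_) fun x hx hx' => ?_
  · simpa using (mem_Icc.1 hx).1
  · refine IncidenceAlgebra.apply_eq_zero_of_not_le (fun hxk => hx' ?_) _
    exact mem_Icc.2 ⟨by simpa using hx, hxk⟩

variable {M : Type*} [AddCommGroup M]

/-- Every function on a finite poset is given by the sums of some function over principal
down-sets. -/
theorem exists_eq_sum_filter_le [PartialOrder α] [DecidableLE α] (F : α → M) :
    ∃ f : α → M, ∀ l, F l = ∑ h with h ≤ l, f h := by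
  classical
  have wf : WellFounded ((· < ·) : α → α → Prop) := wellFounded_lt
  refine ⟨wf.fix (fun x f => F x - ∑ y : {y // y < x}, f y.1 y.2), fun x => ?_⟩
  have hx := wf.fix_eq (fun x (f : ∀ y, y < x → M) => F x - ∑ y : {y // y < x}, f y.1 y.2) x
  set E := wf.fix (fun x (f : ∀ y, y < x → M) => F x - ∑ y : {y // y < x}, f y.1 y.2)
  have hs : univ.filter (· ≤ x) = insert x (univ.filter (· < x)) := by
    ext y; simp [le_iff_eq_or_lt]
  have h2 : ∑ y : {y // y < x}, E y.1 = ∑ y with y < x, E y :=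
    (sum_subtype _ (fun y => by simp) E).symm
  rw [hs, sum_insert (by simp), hx, h2, sub_add_cancel]

variable [Module ℚ M]

theorem sum_mu_smul_eq [PartialOrder α] [LocallyFiniteOrder α] [DecidableLE α] {F f : α → M}
    (hF : ∀ l, F l = ∑ h with h ≤ l, f h) (k : α) :
    ∑ l, IncidenceAlgebra.mu ℚ l k • F l = f k := by
  simp_rw [hF, sum_filter, smul_sum, smul_ite, smul_zero]
  rw [sum_comm]
  have key : ∀ h, ∑ l, (if h ≤ l then IncidenceAlgebra.mu ℚ l k • f h else 0) =
      if h = k then f k else 0 := by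
    intro h
    have := congrArg (· • f h) (sum_ite_mu_eq_ite h k)
    simp only [sum_smul, ite_smul, zero_smul, one_smul] at this
    rw [this]
    split_ifs with e
    · rw [e]
    · rfl
  simp [key]

/-- Weisner's theorem, for functions: a sum over a finite lattice weighted by the Möbius function
`μ(·, k)` vanishes on functions that factor through the meet with an element not above `k`. -/
theorem sum_mu_smul_inf_eq_zero [Lattice α] [LocallyFiniteOrder α] (F : α → M) {k p : α}
    (hp : ¬ k ≤ p) : ∑ l, IncidenceAlgebra.mu ℚ l k • F (p ⊓ l) = 0 := by
  classical
  obtain ⟨f, hf⟩ := exists_eq_sum_filter_le F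
  -- Composing with `p ⊓ ·` cuts the Möbius inverse `f` off outside the down-set of `p`, which does
  -- not contain `k`.
  have h : ∀ l, F (p ⊓ l) = ∑ h with h ≤ l, if h ≤ p then f h else 0 := by
    intro l
    rw [hf, ← sum_filter, filter_filter]
    exact sum_congr (by ext; simp [and_comm]) fun _ _ => rfl
  rw [sum_mu_smul_eq h, if_neg hp]

end MoebiusInversion

/-! ### Reduced Euler characteristics as a coweighting -/

section ReducedEulerChar

variable {G : Type u} [Group G] [Finite G]

-- A coweighting `k` of `S` restricts to one of the down-set `S_{<H}`, so `χ(S_{<H})` is its total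
-- there. The coweighting equation at `H` then reads `k(H) = 1 - χ(S_{<H})`.
open Classical in
theorem sum_neg_reducedEulerCharBelow [Fintype (Subgroup G)] {S : Set (Subgroup G)}
    {C : Subgroup G} (hC : C ∈ S) :
    ∑ H with H ∈ S ∧ H ≤ C, -reducedEulerCharBelow S H = 1 := by
  obtain ⟨k, hk⟩ := exists_isPosetCoweighting S
  set k' : Subgroup G → ℚ := fun H => if h : H ∈ S then k ⟨H, h⟩ else 0 with hk'
  have key : ∀ C ∈ S, ∑ H with H ∈ S ∧ H ≤ C, k' H = 1 := by
    intro C hC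
    rw [← hk ⟨C, hC⟩, finsum_mem_eq_finite_toFinset_sum _ (Set.toFinite _)]
    symm
    refine Finset.sum_bij (fun x _ => x.1) ?_ ?_ ?_ ?_
    · intro x hx
      rw [Set.Finite.mem_toFinset] at hx
      exact Finset.mem_filter.2 ⟨Finset.mem_univ _, x.2, hx⟩
    · intro x _ y _ h
      exact Subtype.ext h
    · intro H hH
      rw [Finset.mem_filter] at hH
      exact ⟨⟨H, hH.2.1⟩, by simpa using hH.2.2, rfl⟩
    · intro x _
      simp [hk']
  have hlt : ∀ H, posetEulerChar {K : Subgroup G // K ∈ S ∧ K < H} =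
      ∑ K with K ∈ S ∧ K < H, k' K := by
    intro H
    have hco : IsPosetCoweighting {K : Subgroup G // K ∈ S ∧ K < H} fun K => k' K.1 := by
      intro y
      rw [← key y.1 y.2.1, finsum_mem_eq_finite_toFinset_sum _ (Set.toFinite _)]
      refine Finset.sum_bij (fun x _ => x.1) ?_ ?_ ?_ ?_
      · intro x hx
        simp only [Set.Finite.mem_toFinset, Set.mem_Iic] at hx
        simpa using ⟨x.2.1, hx⟩
      · intro x _ y _ h
        exact Subtype.ext h
      · intro K hK
        rw [Finset.mem_filter] at hK
        exact ⟨⟨K, hK.2.1, hK.2.2.trans_lt y.2.2⟩, (Set.toFinite _).mem_toFinset.2 hK.2.2, rfl⟩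
      · intro x _
        rfl
    obtain ⟨w, hw⟩ := exists_isPosetWeighting {K : Subgroup G // K ∈ S ∧ K < H}
    rw [posetEulerChar_eq hw, hw.sum_eq hco, finsum_eq_sum_of_fintype]
    exact (Finset.sum_subtype _ (fun y => by simp) k').symm
  rw [← key C hC]
  refine Finset.sum_congr rfl fun H hH => ?_
  have hHS : H ∈ S := (Finset.mem_filter.1 hH).2.1
  have hs : Finset.univ.filter (fun K => K ∈ S ∧ K ≤ H) =
      insert H (Finset.univ.filter fun K => K ∈ S ∧ K < H) := by
    ext K
    simp only [Finset.mem_filter, Finset.mem_univ, true_and, Finset.mem_insert, le_iff_eq_or_lt]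
    constructor
    · rintro ⟨h1, rfl | h2⟩
      · exact Or.inl rfl
      · exact Or.inr ⟨h1, h2⟩
    · rintro (rfl | h)
      · exact ⟨hHS, Or.inl rfl⟩
      · exact ⟨h.1, Or.inr h.2⟩
  have h1 := key H hHS
  rw [hs, Finset.sum_insert (by simp), ← hlt] at h1
  rw [reducedEulerCharBelow, reducedPosetEulerChar]
  linarith

end ReducedEulerChar

/-! ### Double coset sums as averages over the group -/

section DoubleCosets

variable {G : Type u} [Group G]

open Finset

theorem exists_isDoubleCosetTransversal [Finite G] {L K H : Subgroup G} (hL : L ≤ K)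
    (hH : H ≤ K) : ∃ T : Finset G, IsDoubleCosetTransversal L K H T := by
  classical
  cases nonempty_fintype G
  -- `r` sends each element to a chosen representative of its double coset; the transversal is the
  -- set of fixed points of `r` in `K`.
  let r : G → G := fun g => (DoubleCoset.mk L H g : DoubleCoset.Quotient (L : Set G) H).out
  have hr : ∀ g, ∃ l ∈ L, ∃ h ∈ H, r g = l * g * h := fun g => by
    obtain ⟨l, h, hl, hh, e⟩ := DoubleCoset.mk_out_eq_mul L H g
    exact ⟨l, hl, h, hh, e⟩
  have hr' : ∀ g, ∀ l ∈ L, ∀ h ∈ H, r (l * g * h) = r g := fun g l hl h hh => by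
    refine congrArg Quotient.out ?_
    exact ((DoubleCoset.eq L H g (l * g * h)).2 ⟨l, hl, h, hh, rfl⟩).symm
  refine ⟨univ.filter fun t => t ∈ K ∧ r t = t, fun t ht => (mem_filter.1 ht).2.1,
    fun k hk => ⟨r k, ⟨?_, ?_⟩, ?_⟩⟩
  · obtain ⟨l, hl, h, hh, e⟩ := hr k
    refine mem_filter.2 ⟨mem_univ _, ?_, ?_⟩
    · rw [e]
      exact K.mul_mem (K.mul_mem (hL hl) hk) (hH hh)
    · conv_lhs => rw [e]
      exact hr' k l hl h hh
  · obtain ⟨l, hl, h, hh, e⟩ := hr k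
    exact ⟨l⁻¹, L.inv_mem hl, h⁻¹, H.inv_mem hh, by rw [e]; group⟩
  · rintro t ⟨ht, l, hl, h, hh, e⟩
    rw [← (mem_filter.1 ht).2.2, e, hr' t l hl h hh]

theorem mem_conj_smul_iff {H : Subgroup G} {g x : G} :
    x ∈ MulAut.conj g • H ↔ g⁻¹ * x * g ∈ H := by
  rw [Subgroup.mem_pointwise_smul_iff_inv_smul_mem, ← map_inv, MulAut.smul_def,
    MulAut.conj_apply, inv_inv]

open Classical in
/-- The number of ways of writing an element `g` of a double coset `L t H` as `l t h` is the order
of `L ∩ ᵍH`. -/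
theorem card_filter_mul_mul_eq [Fintype G] {L H : Subgroup G} {T : Finset G} {g t l₀ h₀ : G}
    (ht : t ∈ T) (hl₀ : l₀ ∈ L) (hh₀ : h₀ ∈ H) (hg : g = l₀ * t * h₀)
    (huniq : ∀ t' ∈ T, ∀ l ∈ L, ∀ h ∈ H, g = l * t' * h → t' = t) :
    #{p ∈ T ×ˢ (univ : Finset (L × H)) | p.2.1 * p.1 * p.2.2 = g} =
      Nat.card (L ⊓ MulAut.conj g • H : Subgroup G) := by
  rw [Nat.card_eq_fintype_card, ← Finset.card_univ]
  -- A factorization is determined by its `l`, since `t` is unique and `h` is then forced. Comparing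
  -- with `g = l₀ t h₀`, the quotient `l l₀⁻¹` ranges over `L ∩ ᵍH`.
  refine card_bij' (fun p hp => ⟨p.2.1 * l₀⁻¹, ?_⟩)
    (fun x _ => (t, ⟨x * l₀, L.mul_mem x.2.1 hl₀⟩, ⟨t⁻¹ * l₀⁻¹ * (x : G)⁻¹ * g, ?_⟩))
    (fun _ _ => mem_univ _) ?_ ?_ ?_
  · obtain ⟨t', l, h⟩ := p
    rw [mem_filter, mem_product] at hp
    obtain rfl : t' = t := huniq t' hp.1.1 l l.2 h h.2 hp.2.symm
    refine ⟨L.mul_mem l.2 (L.inv_mem hl₀), ?_⟩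
    change _ ∈ MulAut.conj g • H
    have e : (l : G) * l₀⁻¹ = g * (h : G)⁻¹ * h₀ * g⁻¹ := by
      have e1 : (l : G) = g * (h : G)⁻¹ * t'⁻¹ := by rw [← hp.2]; group
      rw [e1]
      conv_rhs => rw [show g⁻¹ = h₀⁻¹ * t'⁻¹ * l₀⁻¹ by rw [hg]; group]
      group
    rw [mem_conj_smul_iff, e]
    convert H.mul_mem (H.inv_mem h.2) hh₀ using 1
    group
  · have hx := mem_conj_smul_iff.1 x.2.2
    have e : t⁻¹ * l₀⁻¹ * (x : G)⁻¹ * g = h₀ * (g⁻¹ * x * g)⁻¹ := by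
      rw [show h₀ = t⁻¹ * l₀⁻¹ * g by rw [hg]; group]
      group
    rw [e]
    exact H.mul_mem hh₀ (H.inv_mem hx)
  · intro x _
    rw [mem_filter, mem_product]
    refine ⟨⟨ht, mem_univ _⟩, ?_⟩
    dsimp only
    group
  · rintro ⟨t', l, h⟩ hp
    rw [mem_filter, mem_product] at hp
    obtain rfl : t' = t := huniq t' hp.1.1 l l.2 h h.2 hp.2.symm
    refine Prod.ext rfl (Prod.ext (Subtype.ext ?_) (Subtype.ext ?_))
    · dsimp only
      group
    · have e : (h : G) = t'⁻¹ * (l : G)⁻¹ * g := by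
        rw [← hp.2]
        group
      change t'⁻¹ * l₀⁻¹ * ((l : G) * l₀⁻¹)⁻¹ * g = h
      rw [e]
      group
  · intro x _
    refine Subtype.ext ?_
    dsimp only
    group

open Classical in
/-- A sum over a double coset transversal as an average over the group. -/
theorem IsDoubleCosetTransversal.card_smul_sum [Fintype G] {M : Type*} [AddCommMonoid M]
    {L K H : Subgroup G} {T : Finset G} (hT : IsDoubleCosetTransversal L K H T) (hL : L ≤ K)
    (hH : H ≤ K) (ψ : G → M) (hψ : ∀ t, ∀ l ∈ L, ∀ h ∈ H, ψ (l * t * h) = ψ t) :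
    (Nat.card L * Nat.card H) • ∑ t ∈ T, ψ t =
      ∑ g with g ∈ K, Nat.card (L ⊓ MulAut.conj g • H : Subgroup G) • ψ g := by
  -- Both sides sum `ψ (l t h)` over all triples `(t, l, h)`; the right-hand side groups them by
  -- their product.
  have h1 : ∑ p ∈ T ×ˢ (univ : Finset (L × H)), ψ (p.2.1 * p.1 * p.2.2) =
      (Nat.card L * Nat.card H) • ∑ t ∈ T, ψ t := by
    rw [sum_product, smul_sum]
    refine sum_congr rfl fun t _ => ?_
    rw [sum_congr rfl fun p _ => hψ t p.1 p.1.2 p.2 p.2.2, sum_const, card_univ,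
      Fintype.card_prod, Nat.card_eq_fintype_card, Nat.card_eq_fintype_card]
  rw [← h1, ← sum_fiberwise_of_maps_to (t := univ.filter (· ∈ K))
    (g := fun p : G × (L × H) => (p.2.1 * p.1 * p.2.2 : G))]
  · refine sum_congr rfl fun g hg => ?_
    obtain ⟨t, ⟨ht, l₀, hl₀, h₀, hh₀, e⟩, hu⟩ := hT.2 g (mem_filter.1 hg).2
    rw [← card_filter_mul_mul_eq ht hl₀ hh₀ e
      fun t' ht' l hl h hh e' => hu t' ⟨ht', l, hl, h, hh, e'⟩, ← sum_const]
    exact sum_congr rfl fun p hp => by rw [(mem_filter.1 hp).2]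
  · rintro ⟨t, l, h⟩ hp
    refine mem_filter.2 ⟨mem_univ _, ?_⟩
    exact K.mul_mem (K.mul_mem (hL l.2) (hT.1 t (mem_product.1 hp).1)) (hH h.2)

end DoubleCosets

/-! ### Normalized induced units and their Möbius inverse -/

namespace RationalGreenFunctor

variable {G : Type u} [Group G] (A : RationalGreenFunctor.{u, v} G)

open Finset

open Classical in
/-- The element `(|L| / |K|) Ind_L^K(1)` of `A(K)`, extended by zero to subgroups `L ≰ K`. -/
noncomputable def normInd (K L : Subgroup G) : A.obj K :=
  if h : L ≤ K then ((Nat.card L : ℚ) / Nat.card K) • A.ind h 1 else 0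

variable {A}

theorem normInd_of_le {K L : Subgroup G} (h : L ≤ K) :
    A.normInd K L = ((Nat.card L : ℚ) / Nat.card K) • A.ind h 1 :=
  dif_pos h

theorem normInd_self [Finite G] (K : Subgroup G) : A.normInd K K = 1 := by
  rw [normInd_of_le le_rfl, A.ind_self, div_self (Nat.cast_ne_zero.2 Nat.card_pos.ne'), one_smul]

theorem ind_normInd [Finite G] {K L M : Subgroup G} (hL : L ≤ K) (hK : K ≤ M) :
    ((Nat.card K : ℚ) / Nat.card M) • A.ind hK (A.normInd K L) = A.normInd M L := by
  rw [normInd_of_le hL, normInd_of_le (hL.trans hK), map_smul, A.ind_ind, smul_smul]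
  have h1 : (Nat.card K : ℚ) ≠ 0 := Nat.cast_ne_zero.2 Nat.card_pos.ne'
  have h2 : (Nat.card M : ℚ) ≠ 0 := Nat.cast_ne_zero.2 Nat.card_pos.ne'
  congr 1
  field_simp

/-- Conjugation by an element of `K` is the identity on `A(K)` and commutes with induction. -/
theorem ind_one_conj {K L L' : Subgroup G} (hL : L ≤ K) (hL' : L' ≤ K) {g : G} (hg : g ∈ K)
    (h : MulAut.conj g • L = L') : A.ind hL' 1 = A.ind hL 1 := by
  have hK : MulAut.conj g • K = K := Subgroup.conj_smul_eq_self_of_mem hg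
  rw [← A.conj_of_mem hg hK (A.ind hL 1), A.conj_ind hL hL' h hK,
    map_one (A.conj g h)]

-- Mackey's formula, averaged over `K`: the normalization absorbs the factors `|N ∩ ᵍL|`, so that
-- `L` enters only through `N ∩ ᵍL`, the form that Weisner's theorem requires.
open Classical in
theorem res_normInd [Fintype G] {N K L : Subgroup G} (hN : N ≤ K) (hL : L ≤ K) :
    A.res hN (A.normInd K L) =
      (Nat.card K : ℚ)⁻¹ • ∑ g with g ∈ K, A.normInd N (N ⊓ MulAut.conj g • L) := by
  obtain ⟨T, hT⟩ := exists_isDoubleCosetTransversal hN hL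
  let ψ : G → A.obj N := fun g => A.ind (inf_le_left : N ⊓ MulAut.conj g • L ≤ N) 1
  have hψ : ∀ t, ∀ n ∈ N, ∀ l ∈ L, ψ (n * t * l) = ψ t := by
    intro t n hn l hl
    refine ind_one_conj _ _ hn ?_
    rw [Subgroup.smul_inf, Subgroup.conj_smul_eq_self_of_mem hn, map_mul, map_mul, mul_smul,
      mul_smul, Subgroup.conj_smul_eq_self_of_mem hl]
  have key := hT.card_smul_sum hN hL ψ hψ
  have hN0 : (Nat.card N : ℚ) ≠ 0 := Nat.cast_ne_zero.2 Nat.card_pos.ne'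
  have hsum : ∑ g with g ∈ K, A.normInd N (N ⊓ MulAut.conj g • L) =
      (Nat.card L : ℚ) • ∑ t ∈ T, ψ t := by
    have : ∀ g, A.normInd N (N ⊓ MulAut.conj g • L) = (Nat.card N : ℚ)⁻¹ •
        (Nat.card (N ⊓ MulAut.conj g • L : Subgroup G) • ψ g) := by
      intro g
      rw [normInd_of_le inf_le_left, ← Nat.cast_smul_eq_nsmul ℚ, smul_smul, div_eq_inv_mul]
    simp_rw [this]
    rw [← smul_sum, ← key, ← Nat.cast_smul_eq_nsmul ℚ, smul_smul]
    congr 1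
    push_cast
    field_simp
  rw [hsum, normInd_of_le hL, map_smul, A.res_ind hN hL T hT, smul_smul, div_eq_inv_mul]
  simp only [map_one, ψ]

/-- An element that restricts to zero on all proper subgroups of a non-primordial subgroup is
zero. -/
theorem eq_zero_of_res_eq_zero {K : Subgroup G} (hK : K ∉ A.primordial) {x : A.obj K}
    (hx : ∀ N (h : N < K), A.res h.le x = 0) : x = 0 := by
  classical
  have hs : Function.Surjective (A.properInduction K) := not_not.1 hK
  obtain ⟨b, hb⟩ := hs 1
  -- As `1` is a sum of properly induced elements, it is enough that `x` kills them, which is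
  -- Frobenius: `x Ind(b) = Ind(Res(x) b)`.
  suffices h : ∀ b, x * A.properInduction K b = 0 by rw [← mul_one x, ← hb, h]
  intro b
  induction b using DirectSum.induction_on with
  | zero => simp
  | of N b =>
    have e : A.properInduction K (DirectSum.of (fun N : {N // N < K} => A.obj N.1) N b) =
        A.ind N.2.le b := by
      rw [properInduction]
      exact DirectSum.toModule_lof (R := ℚ) (φ := fun N : {N // N < K} => A.ind N.2.le) N b
    rw [e, A.mul_ind, hx _ N.2, zero_mul, map_zero]
  | add b c hb hc => rw [map_add, mul_add, hb, hc, add_zero]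

open Classical in
theorem sum_mu_smul_normInd_eq_zero [Fintype (Subgroup G)] [LocallyFiniteOrder (Subgroup G)]
    [Finite G] {K : Subgroup G} (hK : K ∉ A.primordial) :
    ∑ L, IncidenceAlgebra.mu ℚ L K • A.normInd K L = 0 := by
  cases nonempty_fintype G
  refine eq_zero_of_res_eq_zero hK fun N hN => ?_
  have h : ∀ L, A.res hN.le (IncidenceAlgebra.mu ℚ L K • A.normInd K L) =
      (Nat.card K : ℚ)⁻¹ • ∑ g with g ∈ K,
        IncidenceAlgebra.mu ℚ L K • A.normInd N (N ⊓ MulAut.conj g • L) := by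
    intro L
    by_cases hL : L ≤ K
    · rw [map_smul, res_normInd hN.le hL, smul_comm, smul_sum]
    · simp [IncidenceAlgebra.apply_eq_zero_of_not_le hL]
  rw [map_sum, sum_congr rfl fun L _ => h L, ← smul_sum, sum_comm, sum_eq_zero, smul_zero]
  intro g hg
  -- Since `N ∩ ᵍL` is the `g`-conjugate of `g⁻¹Ng ∩ L`, Weisner's theorem applies for each `g ∈ K`
  -- with `p = g⁻¹Ng`, a proper subgroup of `K`.
  have hp : ¬ K ≤ (MulAut.conj g)⁻¹ • N := by
    rw [← Subgroup.pointwise_smul_subset_iff,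
      Subgroup.conj_smul_eq_self_of_mem (mem_filter.1 hg).2]
    exact hN.not_ge
  rw [← sum_mu_smul_inf_eq_zero (fun P => A.normInd N (MulAut.conj g • P)) hp]
  refine sum_congr rfl fun L _ => ?_
  rw [Subgroup.smul_inf, smul_inv_smul]

open Classical in
/-- The elements `(|L| / |G|) Ind_L^G(1)` are sums over the subgroups of `L` of elements indexed by
the primordial subgroups. -/
theorem exists_normInd_eq_sum [Fintype (Subgroup G)] [Finite G] (A : RationalGreenFunctor.{u, v} G) :
    ∃ f : Subgroup G → A.obj ⊤, (∀ L, A.normInd ⊤ L = ∑ K with K ≤ L, f K) ∧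
      ∀ K ∉ A.primordial, f K = 0 := by
  obtain ⟨f, hf⟩ := exists_eq_sum_filter_le (A.normInd ⊤)
  refine ⟨f, hf, fun K hK => ?_⟩
  let _ : LocallyFiniteOrder (Subgroup G) := Fintype.toLocallyFiniteOrder
  rw [← sum_mu_smul_eq hf K]
  -- Only `L ≤ K` contribute, and for these the normalized element of `A(G)` is induced from `A(K)`;
  -- so the whole Möbius sum is.
  have h : ∀ L, IncidenceAlgebra.mu ℚ L K • A.normInd ⊤ L =
      ((Nat.card K : ℚ) / Nat.card (⊤ : Subgroup G)) •
        A.ind le_top (IncidenceAlgebra.mu ℚ L K • A.normInd K L) := by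
    intro L
    by_cases hL : L ≤ K
    · rw [← ind_normInd hL le_top, map_smul, smul_comm]
    · simp [IncidenceAlgebra.apply_eq_zero_of_not_le hL]
  rw [sum_congr rfl fun L _ => h L, ← smul_sum, ← map_sum, sum_mu_smul_normInd_eq_zero hK,
    map_zero, smul_zero]

end RationalGreenFunctor

/-! ### Exchanging the sums through centralizers -/

theorem mainTheorem8 {G : Type u} [Group G] [Finite G]
    (A : RationalGreenFunctor.{u, v} G) (S : Set (Subgroup G))
    (hconj : ∀ H ∈ S, ∀ g : G, MulAut.conj g • H ∈ S)
    (hprim : ∀ K ∈ A.primordial, Subgroup.centralizer (K : Set G) ∈ S) :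
    (1 : A.obj ⊤) =
      ∑ᶠ H ∈ S,
        (-reducedEulerCharBelow S H / ((Subgroup.centralizer (H : Set G)).index : ℚ)) •
          A.ind (le_top : Subgroup.centralizer (H : Set G) ≤ ⊤)
            (1 : A.obj (Subgroup.centralizer (H : Set G))) := by
  classical
  cases nonempty_fintype (Subgroup G)
  obtain ⟨f, hf, hf0⟩ := A.exists_normInd_eq_sum
  have hterm : ∀ H : Subgroup G,
      (-reducedEulerCharBelow S H / ((Subgroup.centralizer (H : Set G)).index : ℚ)) •
          A.ind (le_top : Subgroup.centralizer (H : Set G) ≤ ⊤)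
            (1 : A.obj (Subgroup.centralizer (H : Set G))) =
        ∑ K : Subgroup G, if H ≤ Subgroup.centralizer (K : Set G) then
          (-reducedEulerCharBelow S H) • f K else 0 := by
    intro H
    set C := Subgroup.centralizer (H : Set G) with hC
    have hcard : (Nat.card C : ℚ) * C.index = Nat.card G := by exact_mod_cast C.card_mul_index
    have hC0 : (Nat.card C : ℚ) ≠ 0 := Nat.cast_ne_zero.2 Nat.card_pos.ne'
    have hi0 : (C.index : ℚ) ≠ 0 := Nat.cast_ne_zero.2 C.index_ne_zero_of_finite
    have h1 : (-reducedEulerCharBelow S H / (C.index : ℚ)) • A.ind (le_top : C ≤ ⊤) 1 =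
        (-reducedEulerCharBelow S H) • A.normInd ⊤ C := by
      rw [RationalGreenFunctor.normInd_of_le le_top, smul_smul, Subgroup.card_top, ← hcard]
      congr 1
      field_simp
    rw [h1, hf, Finset.sum_filter, Finset.smul_sum]
    refine Finset.sum_congr rfl fun K _ => ?_
    rw [hC, Subgroup.le_centralizer_iff, smul_ite, smul_zero]
  rw [finsum_mem_eq_finite_toFinset_sum _ (Set.toFinite S),
    Finset.sum_congr rfl fun H _ => hterm H, Finset.sum_comm,
    ← RationalGreenFunctor.normInd_self, hf, Finset.sum_filter]
  refine Finset.sum_congr rfl fun K _ => ?_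
  rw [if_pos le_top]
  -- Only for primordial `K` is `C(K)` known to lie in `S`, making the coefficient `1`; otherwise `f
  -- K = 0` and the coefficient is irrelevant.
  by_cases hK : K ∈ A.primordial
  · rw [← Finset.sum_filter, ← Finset.sum_smul]
    have hs : (Set.toFinite S).toFinset.filter (· ≤ Subgroup.centralizer (K : Set G)) =
        Finset.univ.filter fun H => H ∈ S ∧ H ≤ Subgroup.centralizer (K : Set G) := by
      ext; simp
    rw [hs, sum_neg_reducedEulerCharBelow (hprim K hK), one_smul]
  · simp [hf0 K hK]
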